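/- All relations are Boolean (subsets of $\{0,1\}^k$, $k\ge 1$), and all functions are Boolean of arity at least $1$. For a set $\Gamma$ of relations, $\langle\Gamma\rangle$ is the smallest co-clone containing $\Gamma$ (closed under primitive positive definitions, with equality allowed), $\langle\Gamma\rangle_{\not\exists}$ is the closure of $\Gamma$ under quantifier-free primitive positive definitions (equality allowed), and $\mathrm{pPol}(\Gamma)$ is the set of partial polymorphisms of $\Gamma$. A set $\Gamma$ is a base of a co-clone $\Delta$ if $\langle\Gamma\rangle=\Delta$. For a clone $\mathsf C$ with co-clone $\mathrm{I}\mathsf C=\mathrm{Inv}(\mathsf C)$, a finite set $\Gamma$ of relations is a weak base of $\mathrm{I}\mathsf C$ if $$\mathrm{pPol}(\Gamma)=\bigcup\{\mathrm{pPol}(D) : D=\langle D\rangle_{\not\exists},\ \langle D\rangle=\mathrm{I}\mathsf C\}.$$ A relation $R$ is minimal if no two of its arguments coincide on all tuples of $R$ (that is, the matrix whose rows are the tuples of $R$ has no duplicate columns) and there is no $R'\subsetneq R$ with $\langle \{R'\}\rangle=\langle \{R\}\rangle$; a minimal weak base is a minimal relation $R$ such that $\{R\}$ is a weak base. For $n\ge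 2$ let $\mathsf S^n_{00}$ be the clone of all monotone Boolean functions $f$ with $f(0,\dots,0)=0$ and $f(1,\dots,1)=1$ that are $0$-separating of degree $n$ (any $n$, not necessarily distinct, tuples mapped to $0$ by $f$ have a common coordinate in which they are all $0$), and let $\mathsf{IS}^n_{00}=\mathrm{Inv}(\mathsf S^n_{00})$. **Lemma.** For every $n\ge 2$, the $(n+3)$-ary relation $$R(x_1,\dots,x_n,x,c_0,c_1)\ \equiv\ (x_1\vee\dots\vee x_n)\wedge(x\rightarrow x_1\wedge\dots\wedge x_n)\wedge (c_0=0)\wedge(c_1=1)$$ is a minimal weak base of $\mathsf{IS}^n_{00}$. Moreover, for every base $\Gamma$ of $\mathsf{IS}^n_{00}$, the relation $R$ is definable by a conjunction of (at least one) atoms $S(\mathbf v)$ with $S\in\Gamma$ and $\mathbf v$ a vector over the variables $x_1,\dots,x_n,x,c_0,c_1$, without quantifiers and without equality atoms (except where the equality relation itself belongs to $\Gamma$). -/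

import Mathlib

namespace BooleanClone

/-- A Boolean relation of finite positive arity. -/
structure BoolRel where
  arity : ℕ
  arity_pos : 0 < arity
  tuples : Set (Fin arity → Bool)

/-- A (total) Boolean function of finite positive arity. -/
structure BoolOp where
  arity : ℕ
  arity_pos : 0 < arity
  toFun : (Fin arity → Bool) → Bool

/-- A partial Boolean function of finite positive arity. -/
structure PartialBoolOp where
  arity : ℕ
  arity_pos : 0 < arity
  toFun : (Fin arity → Bool) →. Bool

/-- `f` preserves `R`: applying `f` coordinatewise to tuples of `R` gives a tuple of `R`. -/
def BoolOp.Preserves (f : BoolOp) (R : BoolRel) : Prop :=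
  ∀ t : Fin f.arity → Fin R.arity → Bool, (∀ i, t i ∈ R.tuples) →
    (fun j => f.toFun (fun i => t i j)) ∈ R.tuples

/-- `f` is a partial polymorphism of `R`: whenever `f` is defined at every coordinate of a
sequence of tuples of `R`, the resulting tuple `s` belongs to `R`. -/
def PartialBoolOp.Preserves (f : PartialBoolOp) (R : BoolRel) : Prop :=
  ∀ t : Fin f.arity → Fin R.arity → Bool, (∀ i, t i ∈ R.tuples) →
    ∀ s : Fin R.arity → Bool, (∀ j, s j ∈ f.toFun (fun i => t i j)) → s ∈ R.tuples

/-- `Inv(F)`, also written `IF`: the set of all relations preserved by all functions in `F`. -/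
def invRels (F : Set BoolOp) : Set BoolRel :=
  {R | ∀ f ∈ F, f.Preserves R}

/-- `pPol(Γ)`: the set of all partial polymorphisms of `Γ`. -/
def pPol (Γ : Set BoolRel) : Set PartialBoolOp :=
  {f | ∀ R ∈ Γ, f.Preserves R}

/-- The equality relation on the Boolean domain. -/
def eqRel : BoolRel where
  arity := 2
  arity_pos := by norm_num
  tuples := {t | t 0 = t 1}

/-- `R` has a primitive positive definition over `Γ`:
`R(x) ↔ ∃ y₁ … yₘ, S₁(v₁) ∧ … ∧ Sₖ(vₖ)` with each `Sⱼ` in `Γ ∪ {=}` and each `vⱼ` a vector of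
variables from `x` and `y`. -/
def PPDefinable (Γ : Set BoolRel) (R : BoolRel) : Prop :=
  ∃ (m k : ℕ) (S : Fin k → BoolRel)
    (v : (j : Fin k) → Fin (S j).arity → Fin R.arity ⊕ Fin m),
    0 < k ∧ (∀ j, S j ∈ Γ ∪ {eqRel}) ∧
    ∀ x : Fin R.arity → Bool, x ∈ R.tuples ↔
      ∃ y : Fin m → Bool, ∀ j, (fun i => Sum.elim x y (v j i)) ∈ (S j).tuples

/-- `R` has a quantifier-free primitive positive definition over `Γ` that does not use equality
(unless equality is itself in `Γ`): `R(x) ↔ S₁(v₁) ∧ … ∧ Sₖ(vₖ)` with each `Sⱼ` in `Γ` and each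
`vⱼ` a vector of variables from `x`. -/
def QFPPDefinableNoEq (Γ : Set BoolRel) (R : BoolRel) : Prop :=
  ∃ (k : ℕ) (S : Fin k → BoolRel) (v : (j : Fin k) → Fin (S j).arity → Fin R.arity),
    0 < k ∧ (∀ j, S j ∈ Γ) ∧
    ∀ x : Fin R.arity → Bool, x ∈ R.tuples ↔ ∀ j, (fun i => x (v j i)) ∈ (S j).tuples

/-- `R` has a quantifier-free primitive positive definition over `Γ`, equality being allowed. -/
def QFPPDefinable (Γ : Set BoolRel) (R : BoolRel) : Prop :=
  QFPPDefinableNoEq (Γ ∪ {eqRel}) R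

/-- A co-clone: a set of relations closed under primitive positive definability. -/
def IsCoClone (Δ : Set BoolRel) : Prop :=
  ∀ R, PPDefinable Δ R → R ∈ Δ

/-- `⟨Γ⟩`: the smallest co-clone containing `Γ`. -/
def coCloneClosure (Γ : Set BoolRel) : Set BoolRel :=
  ⋂₀ {Δ | Γ ⊆ Δ ∧ IsCoClone Δ}

/-- The smallest set of relations that contains `Γ` and is closed under quantifier-free
primitive positive definability. -/
def qfppClosure (Γ : Set BoolRel) : Set BoolRel :=
  ⋂₀ {Δ | Γ ⊆ Δ ∧ ∀ R, QFPPDefinable Δ R → R ∈ Δ}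

/-- `Γ` is a base of the co-clone `Δ`. -/
def IsBase (Γ Δ : Set BoolRel) : Prop :=
  coCloneClosure Γ = Δ

/-- The interval of all weak partial co-clones `D` (sets closed under quantifier-free primitive
positive definability) that generate the co-clone `Δ`. -/
def coCloneInterval (Δ : Set BoolRel) : Set (Set BoolRel) :=
  {D | D = qfppClosure D ∧ coCloneClosure D = Δ}

/-- The union of `pPol(D)` over all weak partial co-clones `D` generating `Inv(C)`. -/
def intervalUnion (C : Set BoolOp) : Set PartialBoolOp :=
  ⋃ D ∈ coCloneInterval (invRels C), pPol D

/-- The constraint language (finite set of relations) `Γ` is a weak base of `Inv(C)`. -/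
def IsWeakBase (C : Set BoolOp) (Γ : Set BoolRel) : Prop :=
  Γ.Finite ∧ pPol Γ = intervalUnion C

/-- Listing the tuples of `R` as the rows of a matrix, no two columns (arguments) coincide. -/
def BoolRel.Irredundant (R : BoolRel) : Prop :=
  ∀ i j : Fin R.arity, (∀ t ∈ R.tuples, t i = t j) → i = j

/-- `R` is minimal: it is irredundant, and no proper subrelation generates the same co-clone. -/
def BoolRel.IsMinimal (R : BoolRel) : Prop :=
  R.Irredundant ∧
    ∀ T : Set (Fin R.arity → Bool), T ⊂ R.tuples →
      coCloneClosure {R} ≠ coCloneClosure {⟨R.arity, R.arity_pos, T⟩}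

/-- `R` (as a one-element language) is a minimal weak base of `Inv(C)`. -/
def IsMinimalWeakBase (C : Set BoolOp) (R : BoolRel) : Prop :=
  IsWeakBase C {R} ∧ R.IsMinimal

/-- `f` is `0`-separating of degree `n`: any `n` (not necessarily distinct) tuples that `f` sends
to `0` have a common coordinate at which they are all `0`. -/
def BoolOp.ZeroSeparating (f : BoolOp) (n : ℕ) : Prop :=
  ∀ u : Fin n → Fin f.arity → Bool, (∀ j, f.toFun (u j) = false) →
    ∃ i, ∀ j, u j i = false

/-- Post's clone `S₀₀ⁿ`: the monotone functions preserving both constants that are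
`0`-separating of degree `n`. -/
def cloneS00 (n : ℕ) : Set BoolOp :=
  {f | Monotone f.toFun ∧ f.toFun (fun _ => false) = false ∧ f.toFun (fun _ => true) = true ∧
    f.ZeroSeparating n}

/-- The co-clone `IS₀₀ⁿ`. -/
def coCloneIS00 (n : ℕ) : Set BoolRel :=
  invRels (cloneS00 n)

/-- The relation `OR(x₁, …, xₙ) ∧ (x → x₁ ⋯ xₙ) ∧ F(c₀) ∧ T(c₁)` in the `n + 3` arguments
`x₁, …, xₙ, x, c₀, c₁` (in this order). -/
def relIS00 (n : ℕ) : BoolRel where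
  arity := n + 3
  arity_pos := by omega
  tuples := {t |
    (∃ i : Fin n, t (Fin.castAdd 3 i) = true) ∧
    (t (Fin.natAdd n 0) = true → ∀ i : Fin n, t (Fin.castAdd 3 i) = true) ∧
    t (Fin.natAdd n 1) = false ∧
    t (Fin.natAdd n 2) = true}

end BooleanClone

namespace BooleanClone

/-! ### Definability and preservation -/

/-! Put `C` for the clone and `R` for `relIS00 n`. The operations preserving `R` are exactly `C`,
hence every base `Γ` of the co-clone has polymorphisms `C`. For fixed arity `s`, membership of an
`s`-ary function in `C`, read as a condition on its value table, is therefore a conjunction of atoms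
over `Γ`.

With `s = n + 1`, identify entries of that table via `relIS00Var`. Write the unit tuples and then
the top tuple of `R` as rows: columns of this matrix go to their own variable, and the remaining `u`
are sent where monotonicity and separation suggest. A tuple lies in `R` iff the resulting function
lies in `C`, so `R` is a quantifier-free conjunction of atoms over every base. Consequently `pPol D`
is contained in `pPol {R}` for each `D` in the interval, and the closure of `{R}` attains the bound.

Minimality applies the same definability to the base `{T}`, for a proper subrelation `T`: the atoms
excluding two chosen tuples force a contradiction. -/

theorem QFPPDefinableNoEq.mono {Γ Δ : Set BoolRel} {R : BoolRel} (hΓ : Γ ⊆ Δ)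
    (h : QFPPDefinableNoEq Γ R) : QFPPDefinableNoEq Δ R := by
  obtain ⟨k, S, v, hk, hS, hR⟩ := h
  exact ⟨k, S, v, hk, fun j => hΓ (hS j), hR⟩

theorem QFPPDefinable.ppDefinable {Γ : Set BoolRel} {R : BoolRel} (h : QFPPDefinable Γ R) :
    PPDefinable Γ R := by
  obtain ⟨k, S, v, hk, hS, hR⟩ := h
  exact ⟨0, k, S, fun j i => Sum.inl (v j i), hk, hS, fun x => by simp [hR]⟩

/-- A relation different from the full one is a conjunction of atoms over `Γ` as soon as every
tuple outside of it is excluded by some atom that it implies. -/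
theorem qfppDefinableNoEq_of_separates {Γ : Set BoolRel} {R : BoolRel}
    {x₀ : Fin R.arity → Bool} (hx₀ : x₀ ∉ R.tuples)
    (h : ∀ x ∉ R.tuples, ∃ S ∈ Γ, ∃ v : Fin S.arity → Fin R.arity,
      (∀ y ∈ R.tuples, (fun i => y (v i)) ∈ S.tuples) ∧ (fun i => x (v i)) ∉ S.tuples) :
    QFPPDefinableNoEq Γ R := by
  choose S hS v hv hx using h
  obtain ⟨k, ⟨e⟩⟩ := Finite.exists_equiv_fin {x // x ∉ R.tuples}
  refine ⟨k, fun j => S _ (e.symm j).2, fun j => v _ (e.symm j).2, ?_, fun j => hS _ _, ?_⟩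
  · exact (e ⟨x₀, hx₀⟩).pos
  · refine fun x => ⟨fun hxR j => hv _ _ x hxR, fun hall => ?_⟩
    by_contra hxR
    exact hx x hxR ((e.symm.surjective.forall (p := fun a =>
      (fun i => x (v a.1 a.2 i)) ∈ (S a.1 a.2).tuples)).2 hall ⟨x, hxR⟩)

theorem BoolOp.preserves_eqRel (f : BoolOp) : f.Preserves eqRel :=
  fun _ ht => congrArg f.toFun (funext ht)

theorem PartialBoolOp.preserves_eqRel (f : PartialBoolOp) : f.Preserves eqRel := by
  intro t ht s hs
  have h0 := hs (0 : Fin 2)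
  rw [show (fun i => t i (0 : Fin 2)) = fun i => t i (1 : Fin 2) from funext ht] at h0
  exact Part.mem_unique h0 (hs (1 : Fin 2))

/-- Applying `f` to the witnesses of the rows yields witnesses for the image. -/
theorem isCoClone_setOf_preserves (f : BoolOp) : IsCoClone {R | f.Preserves R} := by
  rintro R ⟨m, k, S, v, -, hS, hR⟩ t ht
  choose y hy using fun i => (hR (t i)).1 (ht i)
  refine (hR _).2 ⟨fun j => f.toFun fun i => y i j, fun j => ?_⟩
  have key : f.Preserves (S j) := by
    rcases hS j with h | h
    · exact h
    · exact Set.mem_singleton_iff.1 h ▸ f.preserves_eqRel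
  convert key (fun i l => Sum.elim (t i) (y i) (v j l)) (fun i => hy i j) using 2 with l
  rcases v j l with a | a <;> rfl

/-- Without quantifiers there are no witnesses at which a partial `f` could be undefined. -/
theorem PartialBoolOp.preserves_of_qfppDefinable {f : PartialBoolOp} {Γ : Set BoolRel}
    {R : BoolRel} (hf : f ∈ pPol Γ) (h : QFPPDefinable Γ R) : f.Preserves R := by
  obtain ⟨k, S, v, -, hS, hR⟩ := h
  intro t ht s hs
  refine (hR s).2 fun j => ?_
  have key : f.Preserves (S j) := by
    rcases hS j with h | h
    · exact hf _ h
    · exact Set.mem_singleton_iff.1 h ▸ f.preserves_eqRel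
  exact key (fun i l => t i (v j l)) (fun i => (hR _).1 (ht i) j) _ fun l => hs (v j l)

/-! ### Closure operators -/

theorem subset_coCloneClosure (Γ : Set BoolRel) : Γ ⊆ coCloneClosure Γ :=
  Set.subset_sInter fun _ h => h.1

theorem coCloneClosure_subset {Γ Δ : Set BoolRel} (h : Γ ⊆ Δ) (hΔ : IsCoClone Δ) :
    coCloneClosure Γ ⊆ Δ :=
  Set.sInter_subset_of_mem ⟨h, hΔ⟩

theorem PPDefinable.mono {Γ Δ : Set BoolRel} {R : BoolRel} (hΓ : Γ ⊆ Δ)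
    (h : PPDefinable Γ R) : PPDefinable Δ R := by
  obtain ⟨m, k, S, v, hk, hS, hR⟩ := h
  exact ⟨m, k, S, v, hk, fun j => Set.union_subset_union_left _ hΓ (hS j), hR⟩

theorem isCoClone_coCloneClosure (Γ : Set BoolRel) : IsCoClone (coCloneClosure Γ) :=
  fun R h _ hΔ => hΔ.2 R (h.mono (coCloneClosure_subset hΔ.1 hΔ.2))

theorem subset_qfppClosure (Γ : Set BoolRel) : Γ ⊆ qfppClosure Γ :=
  Set.subset_sInter fun _ h => h.1

theorem qfppClosure_subset {Γ Δ : Set BoolRel} (h : Γ ⊆ Δ)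
    (hΔ : ∀ R, QFPPDefinable Δ R → R ∈ Δ) : qfppClosure Γ ⊆ Δ :=
  Set.sInter_subset_of_mem ⟨h, hΔ⟩

theorem qfppDefinable_mem_qfppClosure {Γ : Set BoolRel} (R : BoolRel)
    (h : QFPPDefinable (qfppClosure Γ) R) : R ∈ qfppClosure Γ :=
  fun _ hΔ => hΔ.2 R (h.mono (Set.union_subset_union_left _ (qfppClosure_subset hΔ.1 hΔ.2)))

theorem qfppClosure_idem (Γ : Set BoolRel) : qfppClosure (qfppClosure Γ) = qfppClosure Γ :=
  (qfppClosure_subset subset_rfl qfppDefinable_mem_qfppClosure).antisymm (subset_qfppClosure _)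

theorem coCloneClosure_qfppClosure (Γ : Set BoolRel) :
    coCloneClosure (qfppClosure Γ) = coCloneClosure Γ := by
  refine (coCloneClosure_subset ?_ (isCoClone_coCloneClosure Γ)).antisymm
    (coCloneClosure_subset ((subset_qfppClosure Γ).trans (subset_coCloneClosure _))
      (isCoClone_coCloneClosure _))
  exact qfppClosure_subset (subset_coCloneClosure Γ)
    fun R h => isCoClone_coCloneClosure Γ R h.ppDefinable

theorem pPol_qfppClosure (Γ : Set BoolRel) : pPol (qfppClosure Γ) = pPol Γ := by
  refine Set.Subset.antisymm (fun f hf R hR => hf R (subset_qfppClosure Γ hR)) fun f hf R hR => ?_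
  exact qfppClosure_subset (Δ := {R | f.Preserves R}) hf
    (fun R h => PartialBoolOp.preserves_of_qfppDefinable (fun _ h => h) h) hR

theorem isCoClone_invRels (C : Set BoolOp) : IsCoClone (invRels C) :=
  fun R h f hf =>
    have hsub : invRels C ⊆ {R | f.Preserves R} := fun _ hS => hS f hf
    isCoClone_setOf_preserves f R (h.mono hsub)

/-! ### Total polymorphisms and the relations they define -/

/-- `x ↦ x ∘ w` pulls membership in a clone `C = Pol(Γ)` back to a conjunction of atoms
over `Γ`. -/
theorem qfppDefinableNoEq_of_pol {C : Set BoolOp} {Γ : Set BoolRel} {R : BoolRel}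
    (hC : ∀ f : BoolOp, f ∈ C ↔ ∀ S ∈ Γ, f.Preserves S)
    {x₀ : Fin R.arity → Bool} (hx₀ : x₀ ∉ R.tuples) {s : ℕ} (hs : 0 < s)
    (w : (Fin s → Bool) → Fin R.arity)
    (hw : ∀ x : Fin R.arity → Bool, x ∈ R.tuples ↔ (⟨s, hs, fun u => x (w u)⟩ : BoolOp) ∈ C) :
    QFPPDefinableNoEq Γ R := by
  refine qfppDefinableNoEq_of_separates hx₀ fun x hx => ?_
  rw [hw, hC] at hx
  simp only [BoolOp.Preserves, not_forall] at hx
  obtain ⟨S, hS, t, ht, hxt⟩ := hx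
  -- A relation `S` and rows `t` witnessing that the function of `x` is not in `C` give the
  -- excluding atom: its variables are the images under `w` of the columns of `t`.
  exact ⟨S, hS, fun j => w fun i => t i j,
    fun y hy => (hC _).1 ((hw y).1 hy) S hS t ht, hxt⟩

/-- The Galois connection between clones and co-clones, for nonempty relations. -/
theorem invRels_subset_coCloneClosure {C : Set BoolOp} {Γ : Set BoolRel}
    (hC : ∀ f : BoolOp, f ∈ C ↔ ∀ S ∈ Γ, f.Preserves S)
    (hne : ∀ (s : ℕ) (hs : 0 < s), ∃ g, (⟨s, hs, g⟩ : BoolOp) ∉ C)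
    {T : BoolRel} (hT : T ∈ invRels C) (hT₀ : T.tuples.Nonempty) : T ∈ coCloneClosure Γ := by
  obtain ⟨m, ⟨e⟩⟩ := Finite.exists_equiv_fin T.tuples
  have hm : 0 < m := (e ⟨_, hT₀.some_mem⟩).pos
  obtain ⟨M, ⟨w⟩⟩ := Finite.exists_equiv_fin (Fin m → Bool)
  have hM : 0 < M := (w fun _ => false).pos
  -- `F` collects the value tables of the `m`-ary members of `C`, where `m` counts the tuples of
  -- `T`; `T` is the projection of `F` to the columns of its own matrix.
  let F : BoolRel := ⟨M, hM, {y | (⟨m, hm, fun u => y (w u)⟩ : BoolOp) ∈ C}⟩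
  have hF : F ∈ coCloneClosure Γ := by
    obtain ⟨g, hg⟩ := hne m hm
    refine isCoClone_coCloneClosure Γ _ (QFPPDefinable.ppDefinable
      (QFPPDefinableNoEq.mono (Γ := Γ)
        ((subset_coCloneClosure Γ).trans Set.subset_union_left) ?_))
    refine qfppDefinableNoEq_of_pol hC (x₀ := fun i => g (w.symm i)) ?_ hm w fun x => Iff.rfl
    simpa [F] using hg
  refine isCoClone_coCloneClosure Γ _ ?_
  let col : Fin T.arity → Fin M := fun j => w fun i => (e.symm i).1 j
  let S : Fin (T.arity + 1) → BoolRel := Fin.cases F fun _ => eqRel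
  refine ⟨M, T.arity + 1, S, Fin.cases (motive := fun j => Fin (S j).arity → Fin T.arity ⊕ Fin M)
    Sum.inr fun j => (![Sum.inl j, Sum.inr (col j)] : Fin 2 → _), Nat.succ_pos _, ?_, fun x => ?_⟩
  · intro j
    cases j using Fin.cases with
    | zero => exact Or.inl hF
    | succ j => exact Or.inr rfl
  · have step : ∀ y : Fin M → Bool, (y ∈ F.tuples ∧ ∀ j, x j = y (col j)) ↔
        ∀ j : Fin (T.arity + 1), (fun i => Sum.elim x y
          (Fin.cases (motive := fun j => Fin (S j).arity → Fin T.arity ⊕ Fin M)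
            Sum.inr (fun j => (![Sum.inl j, Sum.inr (col j)] : Fin 2 → _)) j i)) ∈ (S j).tuples := by
      intro y
      rw [Fin.forall_fin_succ]
      rfl
    simp only [← step]
    constructor
    · intro hx
      -- A tuple of `T` is witnessed by the projection onto its row.
      refine ⟨fun i => w.symm i (e ⟨x, hx⟩), ?_, fun j => by simp [col]⟩
      refine (hC _).2 fun S _ t ht => ?_
      simpa using ht (e ⟨x, hx⟩)
    · rintro ⟨y, hy, hxy⟩
      have := hT _ hy (fun i => (e.symm i).1) (fun i => (e.symm i).2)
      rwa [funext hxy]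

theorem mem_iff_preserves_of_isBase {C : Set BoolOp} {R : BoolRel} {Γ : Set BoolRel}
    (hC : ∀ f : BoolOp, f ∈ C ↔ f.Preserves R) (hΓ : IsBase Γ (invRels C)) (f : BoolOp) :
    f ∈ C ↔ ∀ S ∈ Γ, f.Preserves S := by
  unfold IsBase at hΓ
  constructor
  · intro hf S hS
    exact (hΓ ▸ subset_coCloneClosure Γ hS : S ∈ invRels C) f hf
  · intro h
    have hR : R ∈ invRels C := fun g hg => (hC g).1 hg
    rw [← hΓ] at hR
    exact (hC f).2 (coCloneClosure_subset (Δ := {R | f.Preserves R}) h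
      (isCoClone_setOf_preserves f) hR)

/-- A single relation that generates the co-clone and is a conjunction of atoms over each of its
bases is a weak base. -/
theorem isWeakBase_singleton {C : Set BoolOp} {R : BoolRel} (hR : IsBase {R} (invRels C))
    (h : ∀ Γ, IsBase Γ (invRels C) → QFPPDefinableNoEq Γ R) : IsWeakBase C {R} := by
  refine ⟨Set.finite_singleton R, Set.Subset.antisymm (fun f hf => ?_) fun f hf => ?_⟩
  · refine Set.mem_iUnion₂.2 ⟨qfppClosure {R}, ⟨(qfppClosure_idem _).symm, ?_⟩, ?_⟩
    · rw [coCloneClosure_qfppClosure, hR]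
    · rwa [pPol_qfppClosure]
  · obtain ⟨D, hD, hfD⟩ := Set.mem_iUnion₂.1 hf
    rintro _ rfl
    exact PartialBoolOp.preserves_of_qfppDefinable hfD ((h D hD.2).mono Set.subset_union_left)

/-! ### The relation `relIS00 n` -/

theorem mem_relIS00 {n : ℕ} {t : Fin (n + 3) → Bool} :
    t ∈ (relIS00 n).tuples ↔ (∃ i : Fin n, t (Fin.castAdd 3 i) = true) ∧
      (t (Fin.natAdd n 0) = true → ∀ i : Fin n, t (Fin.castAdd 3 i) = true) ∧
      t (Fin.natAdd n 1) = false ∧ t (Fin.natAdd n 2) = true :=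
  Iff.rfl

theorem append_mem_relIS00 {n : ℕ} {p : Fin n → Bool} {b c d : Bool} :
    (Fin.append p ![b, c, d] : Fin (n + 3) → Bool) ∈ (relIS00 n).tuples ↔
      (∃ i, p i = true) ∧ (b = true → ∀ i, p i = true) ∧ c = false ∧ d = true := by
  rw [mem_relIS00]
  simp

theorem eq_append {n : ℕ} (t : Fin (n + 3) → Bool) :
    t = Fin.append (fun i => t (Fin.castAdd 3 i))
      ![t (Fin.natAdd n 0), t (Fin.natAdd n 1), t (Fin.natAdd n 2)] := by
  funext j
  cases j using Fin.addCases with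
  | left i => simp
  | right i => fin_cases i <;> simp

theorem forall_fin_add_three {n : ℕ} {P : Fin (n + 3) → Prop} :
    (∀ j, P j) ↔ (∀ i : Fin n, P (Fin.castAdd 3 i)) ∧ P (Fin.natAdd n 0) ∧
      P (Fin.natAdd n 1) ∧ P (Fin.natAdd n 2) := by
  refine ⟨fun h => ⟨fun i => h _, h _, h _, h _⟩, fun ⟨h, h0, h1, h2⟩ j => ?_⟩
  cases j using Fin.addCases with
  | left i => exact h i
  | right i => fin_cases i <;> assumption

theorem mem_cloneS00_iff {n : ℕ} (hn : 2 ≤ n) (f : BoolOp) :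
    f ∈ cloneS00 n ↔ f.Preserves (relIS00 n) := by
  constructor
  · rintro ⟨hmono, h0, h1, hsep⟩ t ht
    refine ⟨?_, fun hx i => ?_, ?_, ?_⟩
    · by_contra! hcon
      obtain ⟨k, hk⟩ := hsep (fun i k => t k (Fin.castAdd 3 i)) fun i => by simpa using hcon i
      obtain ⟨i, hi⟩ := (ht k).1
      simp [hk i] at hi
    · refine Bool.eq_true_of_true_le (hx ▸ hmono fun k => ?_)
      rw [Bool.le_iff_imp]
      exact fun hk => (ht k).2.1 hk i
    · rw [← h0]
      exact congrArg f.toFun (funext fun k => (ht k).2.2.1)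
    · rw [← h1]
      exact congrArg f.toFun (funext fun k => (ht k).2.2.2)
  · intro h
    have key : ∀ (p : Fin n → Fin f.arity → Bool) (b : Fin f.arity → Bool),
        (∀ k, (∃ i, p i k = true) ∧ (b k = true → ∀ i, p i k = true)) →
        (∃ i, f.toFun (p i) = true) ∧ (f.toFun b = true → ∀ i, f.toFun (p i) = true) ∧
          f.toFun (fun _ => false) = false ∧ f.toFun (fun _ => true) = true := by
      intro p b hpb
      have := h (fun k => (Fin.append (fun i => p i k) ![b k, false, true] : Fin (n + 3) → Bool))
        fun k => append_mem_relIS00.2 ⟨(hpb k).1, (hpb k).2, rfl, rfl⟩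
      simpa using mem_relIS00.1 this
    have hpos : 0 < n := by omega
    have hconst := key (fun _ _ => true) (fun _ => false) (by simpa using fun _ => ⟨⟨0, hpos⟩⟩)
    refine ⟨fun u u' huu' => ?_, hconst.2.2.1, hconst.2.2.2, fun u hu => ?_⟩
    · rw [Bool.le_iff_imp]
      -- The other variables are constantly true; since `n ≥ 2` there is one, and it satisfies the
      -- disjunction.
      have := (key (fun i => if i = ⟨0, hpos⟩ then u' else fun _ => true) u fun k =>
        ⟨⟨⟨1, hn⟩, by simp⟩, fun hk i => ?_⟩).2.1
      · intro hu
        simpa using this hu ⟨0, hpos⟩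
      · split_ifs
        · exact Bool.le_iff_imp.1 (huu' k) hk
        · rfl
    · by_contra! hcon
      obtain ⟨i, hi⟩ := (key u (fun _ => false) fun k => ⟨by simpa using hcon k, by simp⟩).1
      simp [hu i] at hi

theorem exists_notMem_cloneS00 (n s : ℕ) (hs : 0 < s) :
    ∃ g, (⟨s, hs, g⟩ : BoolOp) ∉ cloneS00 n :=
  ⟨fun _ => true, fun h => by simpa using h.2.1⟩

theorem isBase_relIS00 {n : ℕ} (hn : 2 ≤ n) : IsBase {relIS00 n} (coCloneIS00 n) := by
  refine Set.Subset.antisymm (coCloneClosure_subset ?_ (isCoClone_invRels _)) fun T hT => ?_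
  · rintro _ rfl f hf
    exact (mem_cloneS00_iff hn f).1 hf
  · rcases T.tuples.eq_empty_or_nonempty with h | h
    · refine isCoClone_coCloneClosure _ _ (QFPPDefinable.ppDefinable
        (QFPPDefinableNoEq.mono (Γ := {relIS00 n})
          ((subset_coCloneClosure _).trans Set.subset_union_left) ?_))
      -- Identifying all arguments of `relIS00 n` is contradictory, as `c₀ = 0` and `c₁ = 1`; this
      -- defines the empty relation.
      refine qfppDefinableNoEq_of_separates (x₀ := fun _ => true) (by simp [h]) fun x _ =>
        ⟨_, rfl, fun _ => ⟨0, T.arity_pos⟩, by simp [h], fun hx => ?_⟩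
      simpa using hx.2.2.1.symm.trans hx.2.2.2
    · exact invRels_subset_coCloneClosure (by simpa using mem_cloneS00_iff hn)
        (exists_notMem_cloneS00 n) hT h

open Classical in
/-- The variable of `relIS00 n` that gives the value of the `(n+1)`-ary function at `u`. -/
noncomputable def relIS00Var (n : ℕ) (u : Fin (n + 1) → Bool) : Fin (n + 3) :=
  if h : ∃ i : Fin n, u i.castSucc = true then
    if ∀ j, u j.castSucc = true → j = h.choose then Fin.castAdd 3 h.choose else Fin.natAdd n 2
  else if u (Fin.last n) = true then Fin.natAdd n 0 else Fin.natAdd n 1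

theorem relIS00Var_none {n : ℕ} {u : Fin (n + 1) → Bool}
    (h : ∀ i : Fin n, u i.castSucc = false) :
    relIS00Var n u = if u (Fin.last n) = true then Fin.natAdd n 0 else Fin.natAdd n 1 := by
  simp [relIS00Var, h]

theorem relIS00Var_single {n : ℕ} {u : Fin (n + 1) → Bool} {i : Fin n}
    (hi : u i.castSucc = true) (h : ∀ j : Fin n, u j.castSucc = true → j = i) :
    relIS00Var n u = Fin.castAdd 3 i := by
  have hex : ∃ i : Fin n, u i.castSucc = true := ⟨i, hi⟩
  have hch := h _ hex.choose_spec
  rw [relIS00Var, dif_pos hex, if_pos (by rwa [hch]), hch]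

theorem relIS00Var_many {n : ℕ} {u : Fin (n + 1) → Bool} {i j : Fin n}
    (hi : u i.castSucc = true) (hj : u j.castSucc = true) (hij : i ≠ j) :
    relIS00Var n u = Fin.natAdd n 2 := by
  have hex : ∃ i : Fin n, u i.castSucc = true := ⟨i, hi⟩
  rw [relIS00Var, dif_pos hex, if_neg fun h => hij ((h i hi).trans (h j hj).symm)]

theorem relIS00Var_mem_cloneS00_iff {n : ℕ} (hn : 2 ≤ n) (x : Fin (n + 3) → Bool) :
    x ∈ (relIS00 n).tuples ↔
      (⟨n + 1, n.succ_pos, fun u => x (relIS00Var n u)⟩ : BoolOp) ∈ cloneS00 n := by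
  let z : Fin n := ⟨0, by omega⟩
  let o : Fin n := ⟨1, hn⟩
  have hzo : z ≠ o := by simp [z, o]
  have hlast : ∀ j : Fin n, j.castSucc ≠ Fin.last n := fun j => (Fin.castSucc_lt_last j).ne
  have hone : ∀ i : Fin n, relIS00Var n
      (fun j => decide (j = i.castSucc ∨ j = Fin.last n)) = Fin.castAdd 3 i := fun i =>
    relIS00Var_single (by simp) fun j hj => by simpa [hlast] using hj
  have hx : relIS00Var n (fun j => decide (j = Fin.last n)) = Fin.natAdd n 0 := by
    rw [relIS00Var_none (by simp [hlast])]; simp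
  constructor
  · rintro ⟨⟨a, ha⟩, himp, h0, h1⟩
    -- The zeros of the function are controlled by one true variable `a`: all of them vanish at
    -- coordinate `a`, which gives separation at once.
    have hzero : ∀ u : Fin (n + 1) → Bool, x (relIS00Var n u) = false →
        u a.castSucc = false ∧ (∀ i j : Fin n, u i.castSucc = true → u j.castSucc = true → i = j) ∧
        (∀ i : Fin n, u i.castSucc = true → x (Fin.castAdd 3 i) = false) ∧
        (u (Fin.last n) = true → x (Fin.natAdd n 0) = false) := by
      intro u hu
      have hmany : ∀ i j : Fin n, u i.castSucc = true → u j.castSucc = true → i = j := by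
        intro i j hi hj
        by_contra hij
        simp [relIS00Var_many hi hj hij, h1] at hu
      have hval : ∀ i : Fin n, u i.castSucc = true → x (Fin.castAdd 3 i) = false := by
        intro i hi
        rwa [relIS00Var_single hi fun j hj => hmany j i hj hi] at hu
      refine ⟨?_, hmany, hval, fun hl => ?_⟩
      · by_contra hcon
        have := hval a (by simpa using hcon)
        simp [ha] at this
      · by_cases hex : ∃ i : Fin n, u i.castSucc = true
        · obtain ⟨i, hi⟩ := hex
          by_contra hcon
          have := himp (by simpa using hcon) i
          simp [hval i hi] at this
        · rwa [relIS00Var_none (by simpa using hex), if_pos hl] at hu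
    refine ⟨fun u u' huu' => ?_, ?_, ?_, fun u hu => ⟨a.castSucc, fun j => (hzero _ (hu j)).1⟩⟩
    · rw [Bool.le_iff_imp]
      intro hu
      by_contra hu'
      obtain ⟨-, hmany, hval, hl⟩ := hzero u' (by simpa using hu')
      have hle : ∀ j, u j = true → u' j = true := fun j => Bool.le_iff_imp.1 (huu' j)
      by_cases hex : ∃ i : Fin n, u i.castSucc = true
      · obtain ⟨i, hi⟩ := hex
        simp only at hu
        rw [relIS00Var_single hi fun j hj => hmany j i (hle _ hj) (hle _ hi),
          hval i (hle _ hi)] at hu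
        simp at hu
      · simp only at hu
        rw [relIS00Var_none (by simpa using hex)] at hu
        split_ifs at hu with hul
        · rw [hl (hle _ hul)] at hu
          simp at hu
        · rw [h0] at hu
          simp at hu
    · simpa [relIS00Var_none] using h0
    · simpa [relIS00Var_many (n := n) (u := fun _ => true) (i := z) (j := o) rfl rfl hzo] using h1
  · rintro ⟨hmono, h0, h1, hsep⟩
    refine ⟨?_, fun hx1 i => ?_, ?_, ?_⟩
    · by_contra! hcon
      -- The columns of `x₁, …, xₙ` have no common zero: the last coordinate is true in all of them,
      -- and coordinate `i` in the `i`-th.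
      obtain ⟨k, hk⟩ := hsep (fun i j => decide (j = i.castSucc ∨ j = Fin.last n)) fun i => by
        simp only [hone i]
        simpa using hcon i
      cases k using Fin.lastCases with
      | last => simpa using hk z
      | cast i => simpa using hk i
    · have := @hmono (fun j => decide (j = Fin.last n))
        (fun j => decide (j = i.castSucc ∨ j = Fin.last n)) fun j => by
          rw [Bool.le_iff_imp]; simpa using Or.inr
      rw [Bool.le_iff_imp] at this
      simp only [hone, hx] at this
      exact this hx1
    · simpa [relIS00Var_none] using h0
    · simpa [relIS00Var_many (n := n) (u := fun _ => true) (i := z) (j := o) rfl rfl hzo] using h1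

theorem qfppDefinableNoEq_relIS00_of_isBase {n : ℕ} (hn : 2 ≤ n) {Γ : Set BoolRel}
    (hΓ : IsBase Γ (coCloneIS00 n)) : QFPPDefinableNoEq Γ (relIS00 n) :=
  qfppDefinableNoEq_of_pol (mem_iff_preserves_of_isBase (mem_cloneS00_iff hn) hΓ)
    (x₀ := fun _ => false) (fun h => by simpa using h.2.2.2) n.succ_pos (relIS00Var n)
    (relIS00Var_mem_cloneS00_iff hn)

/-! ### Minimality -/

/-- The tuple of `relIS00 n` in which the `k`-th variable is the only true one of `x₁, …, xₙ, x`. -/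
def unitTuple {n : ℕ} (k : Fin n) : Fin (n + 3) → Bool :=
  Fin.append (fun i => decide (i = k)) ![false, false, true]

/-- The tuple of `relIS00 n` in which `x` is true. -/
def topTuple (n : ℕ) : Fin (n + 3) → Bool :=
  Fin.append (fun _ => true) ![true, false, true]

theorem unitTuple_mem {n : ℕ} (k : Fin n) : unitTuple k ∈ (relIS00 n).tuples :=
  append_mem_relIS00.2 (by simp)

theorem topTuple_mem {n : ℕ} (hn : 2 ≤ n) : topTuple n ∈ (relIS00 n).tuples :=
  append_mem_relIS00.2 (by simpa using ⟨⟨0, by omega⟩⟩)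

theorem eq_topTuple {n : ℕ} {t : Fin (n + 3) → Bool} (ht : t ∈ (relIS00 n).tuples)
    (hx : t (Fin.natAdd n 0) = true) : t = topTuple n := by
  obtain ⟨-, himp, h0, h1⟩ := ht
  rw [eq_append t, hx, h0, h1, topTuple]
  congr 1
  exact funext (himp hx)

theorem relIS00_irredundant {n : ℕ} (hn : 2 ≤ n) : (relIS00 n).Irredundant := by
  have hne : ∀ k : Fin n, ∃ l : Fin n, k ≠ l := fun k => by
    have : Nontrivial (Fin n) := Fin.nontrivial_iff_two_le.2 hn
    exact (exists_ne k).imp fun _ h => h.symm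
  have hz : Nonempty (Fin n) := ⟨⟨0, by omega⟩⟩
  suffices H : ∀ i j : Fin (n + 3), (∀ k, unitTuple k i = unitTuple k j) →
      topTuple n i = topTuple n j → i = j from
    fun i j h => H i j (fun k => h _ (unitTuple_mem k)) (h _ (topTuple_mem hn))
  rw [forall_fin_add_three]
  simp only [forall_fin_add_three (n := n), unitTuple, topTuple]
  refine ⟨fun i => ⟨fun j h _ => ?_, fun h => ?_, fun _ h => ?_, fun h => ?_⟩,
    ⟨fun i h => ?_, ?_, ?_, ?_⟩, ⟨fun i _ h => ?_, ?_, ?_, ?_⟩, ⟨fun i h => ?_, ?_, ?_, ?_⟩⟩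
  · have := h i
    simp only [Fin.append_left, decide_true] at this
    rw [of_decide_eq_true this.symm]
  · simpa using h i
  · simp at h
  · obtain ⟨l, hl⟩ := hne i
    simpa [hl] using h l
  · simpa using h i
  · simp
  · simp
  · simp
  · simp at h
  · simp
  · simp
  · simp
  · obtain ⟨l, hl⟩ := hne i
    simpa [hl] using h l
  · simp
  · simp
  · simp

theorem relIS00_isMinimal {n : ℕ} (hn : 2 ≤ n) : (relIS00 n).IsMinimal := by
  refine ⟨relIS00_irredundant hn, fun T hT heq => ?_⟩
  have hbase : IsBase {⟨n + 3, (relIS00 n).arity_pos, T⟩} (coCloneIS00 n) :=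
    heq.symm.trans (isBase_relIS00 hn)
  have hnt : Nontrivial (Fin n) := Fin.nontrivial_iff_two_le.2 hn
  have hTR : ∀ t ∈ T, t ∈ (relIS00 n).tuples := fun t ht => hT.1 ht
  have hsep : ∀ x : Fin (n + 3) → Bool, x ∉ (relIS00 n).tuples →
      ∃ v : Fin (n + 3) → Fin (n + 3),
        (∀ y ∈ (relIS00 n).tuples, (fun i => y (v i)) ∈ T) ∧ (fun i => x (v i)) ∉ T := by
    intro x hx
    obtain ⟨k, S, v, -, hS, hR⟩ := qfppDefinableNoEq_relIS00_of_isBase hn hbase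
    have hx' := fun h => hx ((hR x).2 h)
    obtain ⟨j, hj⟩ := not_forall.1 hx'
    have hall := fun y hy => (hR y).1 hy j
    have hSj := Set.mem_singleton_iff.1 (hS j)
    generalize v j = w at hj hall
    revert w
    rw [hSj]
    exact fun w hj hall => ⟨w, hall, hj⟩
  have hconst : ∀ v : Fin (n + 3) → Fin (n + 3),
      (∀ y ∈ (relIS00 n).tuples, (fun i => y (v i)) ∈ T) →
        v (Fin.natAdd n 1) = Fin.natAdd n 1 ∧ v (Fin.natAdd n 2) = Fin.natAdd n 2 := by
    intro v hv
    -- Columns `v c₀` and `v c₁` are constant on `R`, and irredundancy leaves only `c₀` and `c₁`.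
    refine ⟨relIS00_irredundant hn _ _ fun t ht => ?_, relIS00_irredundant hn _ _ fun t ht => ?_⟩
    · exact (hTR _ (hv t ht)).2.2.1.trans ht.2.2.1.symm
    · exact (hTR _ (hv t ht)).2.2.2.trans ht.2.2.2.symm
  have hbot : ∀ r ∈ (relIS00 n).tuples, r (Fin.natAdd n 0) = false → r ∈ T := by
    -- Exclude the tuple violating only the disjunction. If `v` missed some `xₖ`, this tuple would
    -- be indistinguishable from `unitTuple k`.
    obtain ⟨v, hv, hvT⟩ := hsep (Fin.append (fun _ => false) ![false, false, true]) fun h => by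
      simpa using (append_mem_relIS00.1 h).1
    obtain ⟨hv1, hv2⟩ := hconst v hv
    have hrange : ∀ k, ∃ j, v j = Fin.castAdd 3 k := by
      intro k
      by_contra! hcon
      refine hvT ?_
      convert hv _ (unitTuple_mem k) using 2 with j
      revert hcon
      generalize v = w
      intro hcon
      have hagree : ∀ l : Fin (n + 3), l ≠ Fin.castAdd 3 k →
          (Fin.append (fun _ => false) ![false, false, true] : Fin (n + 3) → Bool) l =
            unitTuple k l := by
        rw [forall_fin_add_three]
        simp [unitTuple]
      exact hagree _ (hcon j)
    -- Otherwise the image of `unitTuple k` would be the top tuple, although the position that `v`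
    -- sends to some `xₗ` with `l ≠ k` is false and cannot be `c₀`.
    have hvx : ∀ k : Fin n, unitTuple k (v (Fin.natAdd n 0)) = false := by
      intro k
      by_contra hcon
      have htop := eq_topTuple (hTR _ (hv _ (unitTuple_mem k))) (by simpa using hcon)
      obtain ⟨l, hl⟩ := exists_ne k
      obtain ⟨j, hj⟩ := hrange l
      have hjl : topTuple n j = false := by
        rw [← htop]
        simp only [hj]
        simp [unitTuple, hl]
      revert hj hjl
      revert j
      rw [forall_fin_add_three, hv1, hv2]
      simp [topTuple, Fin.ext_iff]
      omega
    have hvx' : ∀ r : Fin (n + 3) → Bool, r (Fin.natAdd n 0) = false →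
        r (Fin.natAdd n 1) = false → r (v (Fin.natAdd n 0)) = false := by
      intro r hr0 hr1
      revert hvx
      generalize v (Fin.natAdd n 0) = a
      revert a
      rw [forall_fin_add_three]
      refine ⟨fun i h => ?_, fun _ => hr0, fun _ => hr1, fun h => ?_⟩
      · simpa [unitTuple] using h i
      · simp [unitTuple] at h
    have hsurj : ∀ k : Fin n, ∃ i : Fin n, v (Fin.castAdd 3 i) = Fin.castAdd 3 k := by
      intro k
      obtain ⟨j, hj⟩ := hrange k
      revert hj
      revert j
      rw [forall_fin_add_three, hv1, hv2]
      refine ⟨fun i hi => ⟨i, hi⟩, fun h => ?_, fun h => ?_, fun h => ?_⟩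
      · have := hvx k
        simp [h, unitTuple] at this
      · simp [Fin.ext_iff] at h
        omega
      · simp [Fin.ext_iff] at h
        omega
    choose g hg using hsurj
    have hginj : Function.Injective g := fun k l hkl =>
      Fin.castAdd_injective n 3 ((hg k).symm.trans (hkl ▸ hg l))
    have hgsurj := Finite.surjective_of_injective hginj
    intro r hr hrx
    -- `v` permutes `x₁, …, xₙ` and `R` is symmetric in them, so `r` is the image of its permuted
    -- copy and lies in `T`.
    have hr' : (Fin.append (fun k => r (Fin.castAdd 3 (g k))) ![false, false, true] :
        Fin (n + 3) → Bool) ∈ (relIS00 n).tuples := by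
      obtain ⟨i, hi⟩ := hr.1
      obtain ⟨k, rfl⟩ := hgsurj i
      exact append_mem_relIS00.2 ⟨⟨k, hi⟩, by simp⟩
    refine (congrArg (· ∈ T) (funext (forall_fin_add_three.2 ⟨fun i => ?_, ?_, ?_, ?_⟩))).mpr (hv _ hr')
    · obtain ⟨k, rfl⟩ := hgsurj i
      rw [hg k, Fin.append_left]
    · refine hrx.trans (hvx' _ ?_ ?_).symm <;> simp
    · rw [hv1, hr.2.2.1]
      simp
    · rw [hv2, hr.2.2.2]
      simp
  -- `T` is proper and contains everything with `x = 0`, so it lacks the only other tuple; thus `x`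
  -- is constantly false on `T`.
  have htop : topTuple n ∉ T := fun h => hT.2 fun r hr => by
    by_cases hrx : r (Fin.natAdd n 0) = true
    · exact eq_topTuple hr hrx ▸ h
    · exact hbot r hr (by simpa using hrx)
  have hTx : ∀ t ∈ T, t (Fin.natAdd n 0) = false := fun t ht => by
    by_contra hcon
    exact htop (eq_topTuple (hTR t ht) (by simpa using hcon) ▸ ht)
  obtain ⟨k, l, hkl⟩ := exists_pair_ne (Fin n)
  -- Exclude a tuple violating only the implication. Now `v` sends `x` to `c₀`, so the image has `x
  -- = 0`; it dominates the image of `unitTuple k`, satisfies the disjunction and lies in `T` after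
  -- all.
  obtain ⟨v, hv, hvT⟩ := hsep (Fin.append (fun i => decide (i = k)) ![true, false, true])
    fun h => hkl.symm (by simpa using (append_mem_relIS00.1 h).2.1 rfl l)
  obtain ⟨hv1, hv2⟩ := hconst v hv
  have hv0 : v (Fin.natAdd n 0) = Fin.natAdd n 1 :=
    relIS00_irredundant hn _ _ fun t ht => (hTx _ (hv t ht)).trans ht.2.2.1.symm
  have hle : ∀ j : Fin (n + 3), unitTuple k j = true →
      (Fin.append (fun i => decide (i = k)) ![true, false, true] : Fin (n + 3) → Bool) j =
        true := by
    rw [forall_fin_add_three]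
    simp [unitTuple]
  refine hvT (hbot _ (mem_relIS00.2 ⟨?_, ?_, ?_, ?_⟩) ?_)
  · exact (hTR _ (hv _ (unitTuple_mem k))).1.imp fun i hi => hle _ hi
  · simp [hv0]
  · simp [hv1]
  · simp [hv2]
  · simp [hv0]

end BooleanClone

theorem mainTheorem2 (n : ℕ) (hn : 2 ≤ n) :
    BooleanClone.IsMinimalWeakBase (BooleanClone.cloneS00 n) (BooleanClone.relIS00 n) ∧
    ∀ Γ : Set BooleanClone.BoolRel,
      BooleanClone.IsBase Γ (BooleanClone.coCloneIS00 n) →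
        BooleanClone.QFPPDefinableNoEq Γ (BooleanClone.relIS00 n) :=
  have h : ∀ Γ, BooleanClone.IsBase Γ (BooleanClone.coCloneIS00 n) →
      BooleanClone.QFPPDefinableNoEq Γ (BooleanClone.relIS00 n) :=
    fun _ => BooleanClone.qfppDefinableNoEq_relIS00_of_isBase hn
  ⟨⟨BooleanClone.isWeakBase_singleton (BooleanClone.isBase_relIS00 hn) h,
    BooleanClone.relIS00_isMinimal hn⟩, h⟩
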